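/- **Theorem 3.3.** Let $a<b$ and $c$ be real numbers, and let $\mathcal H$ be the set of functions $h:[a,b]\to[0,1]$ that are twice differentiable on $[a,b]$ with $\sup_{x\in[a,b]}|h''(x)|\le c$. Let $s_0\ge 3$ be an integer, let $K_n\ge s_0$ be integers with $K_n\to\infty$, and let $\Phi_n=(\Phi_{n,1},\dots,\Phi_{n,K_n})'$ be the vector of the $K_n$ B-splines of order $s_0$ (degree $s_0-1$) for a nondecreasing knot sequence whose basic interval is $[a,b]$ and whose $K_n-s_0$ interior knots are evenly spaced, i.e. they divide $[a,b]$ into $K_n-s_0+1$ intervals of equal length; the $s_0-1$ boundary knots in $(-\infty,a]$ and the $s_0-1$ boundary knots in $[b,\infty)$ are arbitrary (for instance all equal to $a$, respectively $b$). Here B-splines are defined by the Cox–de Boor recursion and taken left-continuous at $b$. Then there is a sequence of positive scalars $\kappa_n\to0$ with $\kappa_n=O(K_n^{-1/2})$ such that, for every $n$ and every $h\in\mathcal H$, there is $\beta_n\in\mathbb R^{K_n}$ with $$\sup_{x\in[a,b]}|\Phi_n(x)'\beta_n-h(x)|\le\kappa_n$$ and, for all $x\in[a,b]$, $$0\le \Phi_n(x)'\beta_n\le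 1,\qquad \Big|\frac{\partial^2}{\partial x^2}\Phi_n(x)'\beta_n\Big|\le c .$$ The spline $\Phi_n'\beta_n$ is differentiable on $[a,b]$ and its derivative is differentiable outside a finite subset of $[a,b)$; at the points of that finite set the second derivative is defined by right-continuity, and derivatives at $a$ and $b$ are one-sided. -/

import Mathlib

open Set Filter Topology

noncomputable section

namespace SplineApprox

/-- `f₂` is the second derivative of `f` on `[a, b]` (one-sided at the end points), with the
convention of right-continuity at a finite set of points where it need not exist: `f` is
differentiable on `[a, b]`, outside a finite set `F ⊆ [a, b)` the number `f₂ x` is the derivative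
of `f'` at `x`, and at a point `x` of `F` it is the limit of `f₂` from the right.
These conditions determine `f₂` on `[a, b]`. -/
def IsSecondDeriv (a b : ℝ) (f f₂ : ℝ → ℝ) : Prop :=
  DifferentiableOn ℝ f (Icc a b) ∧
    ∃ F : Finset ℝ, (F : Set ℝ) ⊆ Ico a b ∧
      (∀ x ∈ Icc a b, x ∉ F →
        HasDerivWithinAt (derivWithin f (Icc a b)) (f₂ x) (Icc a b) x) ∧
      ∀ x ∈ F, Tendsto f₂ (𝓝[>] x) (𝓝 (f₂ x))

/-- The vector `(f, -f, f'', -f'')` at `x`, where `f₂` is the second derivative of `f`. -/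
def constraintVec (f f₂ : ℝ → ℝ) (x : ℝ) : Fin 4 → ℝ := ![f x, -f x, f₂ x, -f₂ x]

/-- `f` is in the domain of `T[f] = (f, -f, f'', -f'')` and `T[f](x) ≤ (1, 0, c, c)` componentwise
at every `x ∈ [a, b]`; that is, `0 ≤ f ≤ 1` and `|f''| ≤ c` on `[a, b]`. -/
def MeetsConstraints (a b c : ℝ) (f : ℝ → ℝ) : Prop :=
  ∃ f₂ : ℝ → ℝ, IsSecondDeriv a b f f₂ ∧
    ∀ x ∈ Icc a b, constraintVec f f₂ x ≤ ![1, 0, c, c]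

/-- The functions from `[a, b]` to `[0, 1]` that are twice differentiable at every point of
`[a, b]` (one-sided at the end points) with second derivative bounded by `c` in absolute value.
Values outside `[a, b]` are irrelevant. -/
def parameterSpace (a b c : ℝ) : Set (ℝ → ℝ) :=
  {h | MapsTo h (Icc a b) (Icc 0 1) ∧
    DifferentiableOn ℝ h (Icc a b) ∧
    DifferentiableOn ℝ (derivWithin h (Icc a b)) (Icc a b) ∧
    ∀ x ∈ Icc a b, |derivWithin (derivWithin h (Icc a b)) (Icc a b) x| ≤ c}

/-- The linear combination `Φ' β` of the components of a vector of functions. -/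
def linComb {k : ℕ} (Φ : Fin k → ℝ → ℝ) (β : Fin k → ℝ) (x : ℝ) : ℝ := ∑ i, β i * Φ i x

/-- `κ` is a sequence of positive scalars that tends to zero and bounds the error of
sup-norm approximation on `[a, b]` of the elements of the parameter space by linear combinations
of the components of `Φ n` that obey the constraints. -/
def ApproximationAssumption (a b c : ℝ) (K : ℕ → ℕ) (Φ : ∀ n, Fin (K n) → ℝ → ℝ)
    (κ : ℕ → ℝ) : Prop :=
  (∀ n, 0 < κ n) ∧ Tendsto κ atTop (𝓝 0) ∧
    ∀ n, ∀ h ∈ parameterSpace a b c, ∃ β : Fin (K n) → ℝ,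
      (∀ x ∈ Icc a b, |linComb (Φ n) β x - h x| ≤ κ n) ∧
      MeetsConstraints a b c (linComb (Φ n) β)

/-- The `i`-th B-spline of degree `d` (order `d + 1`) for the knot sequence `t`, by the
Cox-de Boor recursion (where `x / 0 = 0`, as is customary there). B-splines of degree `0` are
indicators of `[t i, t (i + 1))`; from `b`, the right end of the basic interval, onwards they are
indicators of `(t i, t (i + 1)]`, which makes all B-splines left-continuous at `b`. -/
def bspline (b : ℝ) (t : ℕ → ℝ) : ℕ → ℕ → ℝ → ℝ
  | 0, i, x =>
      open Classical in
      if x < b then (if t i ≤ x ∧ x < t (i + 1) then 1 else 0)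
      else (if t i < x ∧ x ≤ t (i + 1) then 1 else 0)
  | d + 1, i, x =>
      (x - t i) / (t (i + d + 1) - t i) * bspline b t d i x +
        (t (i + d + 2) - x) / (t (i + d + 2) - t (i + 1)) * bspline b t d (i + 1) x

/-- `t 0 ≤ t 1 ≤ …` is a knot sequence for a vector of `k` B-splines of order `s` on `[a, b]` with
evenly spaced knots: `t (s - 1) = a`, `t k = b`, and the knots between them, which are the `k - s`
interior knots, divide `[a, b]` into `k - s + 1` intervals of equal length. The `s - 1` boundary
knots on either side are arbitrary; they may all coincide with the end points, or
continue the even spacing. -/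
def IsEvenKnotSeq (a b : ℝ) (s k : ℕ) (t : ℕ → ℝ) : Prop :=
  Monotone t ∧
    ∀ j : ℕ, j + s ≤ k + 1 → t (s - 1 + j) = a + j * ((b - a) / ((k : ℝ) - s + 1))

/-- The vector of the `k` B-splines of order `s` for the knot sequence `t`. -/
def bsplineVec (b : ℝ) (s k : ℕ) (t : ℕ → ℝ) (i : Fin k) (x : ℝ) : ℝ := bspline b t (s - 1) i x

end SplineApprox

end

noncomputable section

namespace SplineApprox

/-! The derivative `h'` is `c`-Lipschitz. Apply Schoenberg's operator to it: take the spline of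
degree `s₀ - 2` whose coefficients are the values of `h'` at the knot averages, projected to `[a,
b]`. Differentiating a spline divides coefficient differences by the spacing of exactly these
averages (`knotAverage_succ_sub`), so the coefficients of the next derivative are bounded by `c`. As
B-splines are nonnegative and sum to one, the derivative itself is bounded by `c`, with no loss in
the constant.

By local support and even spacing `δ`, this spline is within `c (s₀ - 1) δ` of `h'`. Integration
gives a spline within some `ε = O(1 / K_n)` of `h` (`exists_spline_approx`). The map `y ↦ (y + ε) /
(1 + 2ε)` then forces the values into `[0, 1]`; being a contraction, it keeps the bound on the
second derivative, and the error becomes at most `2ε`.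

B-splines are handled through their polynomial pieces, for which the derivative formula is an
algebraic identity; the pieces are glued at the simple knots in `[a, b]`. -/

/-- The polynomial that agrees with the `i`-th B-spline of degree `d` on the `j`-th knot
interval. -/
def bsplinePiece (t : ℕ → ℝ) (j : ℕ) : ℕ → ℕ → ℝ → ℝ
  | 0, i, _ => if i = j then 1 else 0
  | d + 1, i, x =>
      (x - t i) / (t (i + d + 1) - t i) * bsplinePiece t j d i x +
        (t (i + d + 2) - x) / (t (i + d + 2) - t (i + 1)) * bsplinePiece t j d (i + 1) x

/-- The spline of degree `d` with coefficients `β 0, …, β (k - 1)`. -/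
def spline (b : ℝ) (t : ℕ → ℝ) (k d : ℕ) (β : ℕ → ℝ) (x : ℝ) : ℝ :=
  ∑ i ∈ Finset.range k, β i * bspline b t d i x

/-- The coefficients of the derivative of a spline of degree `d + 1`. -/
def derivCoeff (t : ℕ → ℝ) (d : ℕ) (β : ℕ → ℝ) : ℕ → ℝ
  | 0 => 0
  | i + 1 => (d + 1) * (β (i + 1) - β i) / (t (i + 1 + d + 1) - t (i + 1))

/-- The `i`-th knot average of order `d + 1`. -/
def knotAverage (t : ℕ → ℝ) (d i : ℕ) : ℝ := (∑ l ∈ Finset.range (d + 1), t (i + 1 + l)) / (d + 1)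

/-- A knot sequence with simple knots `a = t d < ⋯ < t k = b`. -/
structure IsSimpleKnotSeq (a b : ℝ) (d k : ℕ) (t : ℕ → ℝ) : Prop where
  monotone : Monotone t
  lt : d < k
  left : t d = a
  right : t k = b
  step : ∀ j, d ≤ j → j < k → t j < t (j + 1)

variable {t : ℕ → ℝ} {a b c : ℝ} {j k d : ℕ}

/-! ### Polynomial pieces of B-splines -/

theorem bsplinePiece_eq_zero {e i : ℕ} (h : ¬ (i ≤ j ∧ j ≤ i + e)) (x : ℝ) :
    bsplinePiece t j e i x = 0 := by
  induction e generalizing i with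
  | zero => rw [bsplinePiece, if_neg (by omega)]
  | succ e ih => rw [bsplinePiece, ih (by omega), ih (by omega)]; simp

theorem continuous_bsplinePiece (e i : ℕ) : Continuous (bsplinePiece t j e i) := by
  induction e generalizing i with
  | zero => exact continuous_const
  | succ e ih =>
    have h₁ := ih i
    have h₂ := ih (i + 1)
    change Continuous fun x => (x - t i) / (t (i + e + 1) - t i) * bsplinePiece t j e i x +
        (t (i + e + 2) - x) / (t (i + e + 2) - t (i + 1)) * bsplinePiece t j e (i + 1) x
    fun_prop

theorem hasDerivAt_bsplinePiece (ht : Monotone t) (e i : ℕ) (x : ℝ) :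
    HasDerivAt (bsplinePiece t j (e + 1) i)
      ((e + 1) * (bsplinePiece t j e i x / (t (i + e + 1) - t i) -
        bsplinePiece t j e (i + 1) x / (t (i + 1 + e + 1) - t (i + 1)))) x := by
  have key : ∀ (e i : ℕ) (p q : ℝ), HasDerivAt (bsplinePiece t j e i) p x →
      HasDerivAt (bsplinePiece t j e (i + 1)) q x →
      HasDerivAt (bsplinePiece t j (e + 1) i)
        ((1 / (t (i + e + 1) - t i) * bsplinePiece t j e i x + (x - t i) / (t (i + e + 1) - t i) * p)
        + (-1 / (t (i + e + 2) - t (i + 1)) * bsplinePiece t j e (i + 1) x +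
          (t (i + e + 2) - x) / (t (i + e + 2) - t (i + 1)) * q)) x := by
    intro e i p q hp hq
    exact ((((hasDerivAt_id x).sub_const _).div_const _).mul hp).add
      ((((hasDerivAt_id x).const_sub _).div_const _).mul hq)
  induction e generalizing i with
  | zero =>
    refine (key 0 i 0 0 (hasDerivAt_const _ _) (hasDerivAt_const _ _)).congr_deriv ?_
    rw [show i + 1 + 0 + 1 = i + 0 + 2 by omega]
    push_cast
    ring
  | succ e ih =>
    refine (key (e + 1) i _ _ (ih i) (ih (i + 1))).congr_deriv ?_
    simp only [bsplinePiece]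
    have e1 : i + (e + 1) + 1 = i + e + 2 := by omega
    have e2 : i + (e + 1) + 2 = i + e + 3 := by omega
    have e3 : i + 1 + e + 1 = i + e + 2 := by omega
    have e4 : i + 1 + e + 2 = i + e + 3 := by omega
    have e5 : i + 1 + (e + 1) + 1 = i + e + 3 := by omega
    have e6 : i + 1 + 1 + e + 1 = i + e + 3 := by omega
    have e7 : i + 1 + 1 = i + 2 := by omega
    simp only [e1, e2, e3, e4, e5, e6, e7]
    have m1 : t i ≤ t (i + 1) := ht (by omega)
    have m2 : t (i + 1) ≤ t (i + e + 2) := ht (by omega)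
    have m3 : t (i + e + 2) ≤ t (i + e + 3) := ht (by omega)
    generalize bsplinePiece t j e (i + 1) x = q
    generalize bsplinePiece t j e i x = p
    generalize bsplinePiece t j e (i + 2) x = r
    -- On either side the two weights add up to one, unless the inner knots coincide; then the
    -- common factor is a division by zero, hence zero.
    have hid : (x - t i) / (t (i + e + 2) - t i) * (q / (t (i + e + 2) - t (i + 1))) +
        (t (i + e + 2) - x) / (t (i + e + 2) - t i) * (q / (t (i + e + 2) - t (i + 1))) =
        (t (i + e + 3) - x) / (t (i + e + 3) - t (i + 1)) * (q / (t (i + e + 2) - t (i + 1))) +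
        (x - t (i + 1)) / (t (i + e + 3) - t (i + 1)) * (q / (t (i + e + 2) - t (i + 1))) := by
      rcases m2.eq_or_lt with h | h
      · simp [h]
      · rw [← add_mul, ← add_mul, ← add_div, ← add_div]
        have h1 : t (i + e + 2) - t i ≠ 0 := by linarith
        have h2 : t (i + e + 3) - t (i + 1) ≠ 0 := by linarith
        rw [show x - t i + (t (i + e + 2) - x) = t (i + e + 2) - t i by ring,
          show t (i + e + 3) - x + (x - t (i + 1)) = t (i + e + 3) - t (i + 1) by ring,
          div_self h1, div_self h2]
    push_cast
    linear_combination (-(e : ℝ) - 1) * hid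

/-- Continuity of B-splines of positive degree at a simple knot: it holds for hat functions, and the
recursion preserves it. -/
theorem bsplinePiece_right_knot (h₁ : t j < t (j + 1)) (h₂ : t (j + 1) < t (j + 2)) (e i : ℕ) :
    bsplinePiece t j (e + 1) i (t (j + 1)) = bsplinePiece t (j + 1) (e + 1) i (t (j + 1)) := by
  induction e generalizing i with
  | zero =>
    have h₁' := (sub_pos.2 h₁).ne'
    have h₂' := (sub_pos.2 h₂).ne'
    simp only [bsplinePiece, add_zero]
    rcases eq_or_ne i j with rfl | hij
    · simp [h₁', h₂']
    · by_cases h : i = j + 1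
      · subst h; simp [show j + 1 + 1 ≠ j by omega]
      · by_cases h' : i + 1 = j
        · subst h'; simp [show i ≠ i + 1 + 1 by omega]
        · simp [hij, h, h']
  | succ e ih =>
    rw [bsplinePiece.eq_2 t j, bsplinePiece.eq_2 t (j + 1), ih, ih]

theorem bsplinePiece_nonneg (ht : Monotone t) {x : ℝ} (hx : x ∈ Icc (t j) (t (j + 1))) (e i : ℕ) :
    0 ≤ bsplinePiece t j e i x := by
  induction e generalizing i with
  | zero => rw [bsplinePiece]; split_ifs <;> norm_num
  | succ e ih =>
    rw [bsplinePiece]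
    refine add_nonneg ?_ ?_
    · by_cases h : i ≤ j ∧ j ≤ i + e
      · have h1 : t i ≤ t j := ht h.1
        exact mul_nonneg (div_nonneg (by linarith [hx.1]) (sub_nonneg.2 (ht (by omega)))) (ih i)
      · rw [bsplinePiece_eq_zero h, mul_zero]
    · by_cases h : i + 1 ≤ j ∧ j ≤ i + 1 + e
      · have h1 : t (j + 1) ≤ t (i + e + 2) := ht (by omega)
        exact mul_nonneg (div_nonneg (by linarith [hx.2]) (sub_nonneg.2 (ht (by omega))))
          (ih (i + 1))
      · rw [bsplinePiece_eq_zero h, mul_zero]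

/-- The two weights that the recursion gives to each lower-degree B-spline add up to one, so passing
to degree `e + 1` adds a telescoping sum. Its end terms vanish because the supports of indices `0`
and `k` miss the `j`-th interval. -/
theorem sum_bsplinePiece (ht : Monotone t) (hj : t j < t (j + 1)) {e : ℕ} (he : e ≤ j)
    (hk : j < k) (x : ℝ) : ∑ i ∈ Finset.range k, bsplinePiece t j e i x = 1 := by
  induction e with
  | zero => simp [bsplinePiece, hk]
  | succ e ih =>
    have hsplit : ∀ i, (x - t i) / (t (i + e + 1) - t i) * bsplinePiece t j e i x =
        bsplinePiece t j e i x -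
          (t (i + e + 1) - x) / (t (i + e + 1) - t i) * bsplinePiece t j e i x := by
      intro i
      by_cases h : i ≤ j ∧ j ≤ i + e
      · have h1 : t i ≤ t j := ht h.1
        have h2 : t (j + 1) ≤ t (i + e + 1) := ht (by omega)
        have h3 : t (i + e + 1) - t i ≠ 0 := by linarith
        field_simp
        ring
      · simp [bsplinePiece_eq_zero h]
    have hterm : ∀ i, bsplinePiece t j (e + 1) i x = bsplinePiece t j e i x +
        ((t (i + 1 + e + 1) - x) / (t (i + 1 + e + 1) - t (i + 1)) * bsplinePiece t j e (i + 1) x -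
          (t (i + e + 1) - x) / (t (i + e + 1) - t i) * bsplinePiece t j e i x) := by
      intro i
      rw [bsplinePiece, hsplit, show i + 1 + e + 1 = i + e + 2 by omega]
      ring
    rw [Finset.sum_congr rfl fun i _ => hterm i, Finset.sum_add_distrib, ih (by omega),
      Finset.sum_range_sub fun i =>
        (t (i + e + 1) - x) / (t (i + e + 1) - t i) * bsplinePiece t j e i x,
      bsplinePiece_eq_zero (i := k) (by omega), bsplinePiece_eq_zero (i := 0) (by omega)]
    simp

/-! ### B-splines and splines on the basic interval -/

namespace IsSimpleKnotSeq

variable (H : IsSimpleKnotSeq a b d k t)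
include H

theorem bspline_eq_piece {x : ℝ} (hd : d ≤ j) (hk : j < k) (hx : x ∈ Icc (t j) (t (j + 1)))
    (hx' : x < t (j + 1) ∨ j + 1 = k) (e i : ℕ) :
    bspline b t e i x = bsplinePiece t j e i x := by
  induction e generalizing i with
  | zero =>
    have hm := H.monotone
    have hs := H.step j hd hk
    have hjb : t (j + 1) ≤ b := H.right ▸ hm (by omega)
    rw [bspline, bsplinePiece]
    by_cases hxb : x < b
    · have hxj : x < t (j + 1) := by
        rcases hx' with h | h
        · exact h
        · rwa [h, H.right]
      rw [if_pos hxb]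
      by_cases hij : i = j
      · subst hij; rw [if_pos ⟨hx.1, hxj⟩, if_pos rfl]
      · rw [if_neg hij, if_neg]
        rintro ⟨h1, h2⟩
        rcases lt_or_gt_of_ne hij with h | h
        · linarith [hm (show i + 1 ≤ j from h), hx.1]
        · linarith [hm (show j + 1 ≤ i from h)]
    · have hjk : j + 1 = k := hx'.resolve_left fun h => hxb (h.trans_le hjb)
      have hxj : x = t (j + 1) := le_antisymm hx.2 (by rw [hjk, H.right]; exact not_lt.1 hxb)
      rw [if_neg hxb, hxj]
      by_cases hij : i = j
      · subst hij; rw [if_pos ⟨hs, le_rfl⟩, if_pos rfl]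
      · rw [if_neg hij, if_neg]
        rintro ⟨h1, h2⟩
        rcases lt_or_gt_of_ne hij with h | h
        · linarith [hm (show i + 1 ≤ j from h)]
        · linarith [hm (show j + 1 ≤ i from h)]
  | succ e ih => rw [bspline, bsplinePiece, ih, ih]

theorem bspline_succ_eq_piece {x : ℝ} (hd : d ≤ j) (hk : j < k)
    (hx : x ∈ Icc (t j) (t (j + 1))) (e i : ℕ) :
    bspline b t (e + 1) i x = bsplinePiece t j (e + 1) i x := by
  by_cases h : x < t (j + 1) ∨ j + 1 = k
  · exact H.bspline_eq_piece hd hk hx h _ i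
  · push Not at h
    obtain rfl : x = t (j + 1) := le_antisymm hx.2 h.1
    have hs := H.step (j + 1) (by omega) (by omega)
    rw [bsplinePiece_right_knot (H.step j hd hk) hs]
    exact H.bspline_eq_piece (by omega) (by omega) ⟨le_rfl, hs.le⟩ (Or.inl hs) _ i

theorem exists_piece {x : ℝ} (hx : x ∈ Icc a b) :
    ∃ j, d ≤ j ∧ j < k ∧ x ∈ Icc (t j) (t (j + 1)) ∧ (x < t (j + 1) ∨ j + 1 = k) := by
  have hex : ∃ j, d ≤ j ∧ (x < t (j + 1) ∨ j + 1 = k) :=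
    ⟨k - 1, by have := H.lt; omega, Or.inr (by have := H.lt; omega)⟩
  classical
  obtain ⟨h1, h2⟩ := Nat.find_spec hex
  have hmin := fun n => Nat.find_min (m := n) hex
  generalize Nat.find hex = j at h1 h2 hmin
  have hjk : j < k := by
    by_contra hjk
    have hlt := H.lt
    exact hmin (k - 1) (by omega) ⟨by omega, Or.inr (by omega)⟩
  refine ⟨j, h1, hjk, ⟨?_, ?_⟩, h2⟩
  · rcases h1.eq_or_lt with h | h
    · rw [← h, H.left]; exact hx.1
    · have := hmin (j - 1) (by omega)
      by_contra hlt
      refine this ⟨by omega, Or.inl ?_⟩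
      rw [show j - 1 + 1 = j by omega]
      exact not_le.1 hlt
  · rcases h2 with h | h
    · exact h.le
    · rw [h, H.right]; exact hx.2

theorem bspline_nonneg {x : ℝ} (hx : x ∈ Icc a b) (e i : ℕ) : 0 ≤ bspline b t e i x := by
  obtain ⟨j, hd, hk, hj, hj'⟩ := H.exists_piece hx
  rw [H.bspline_eq_piece hd hk hj hj']
  exact bsplinePiece_nonneg H.monotone hj e i

theorem sum_bspline {x : ℝ} (hx : x ∈ Icc a b) {e : ℕ} (he : e ≤ d) :
    ∑ i ∈ Finset.range k, bspline b t e i x = 1 := by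
  obtain ⟨j, hd, hk, hj, hj'⟩ := H.exists_piece hx
  simp_rw [H.bspline_eq_piece hd hk hj hj']
  exact sum_bsplinePiece H.monotone (H.step j hd hk) (he.trans hd) hk x

/-- Differentiate on each closed knot interval, sum by parts, and glue the intervals. The hypothesis
`hx` makes the one-sided derivatives agree; it is automatic for `e ≥ 1`, and for `e = 0` it excludes
the interior knots. -/
theorem hasDerivWithinAt_spline_of_eq_piece {e : ℕ} (he : e + 1 ≤ d) (β : ℕ → ℝ) {x : ℝ}
    (hx : ∀ j, d ≤ j → j < k → x ∈ Icc (t j) (t (j + 1)) →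
      ∀ i, bspline b t e i x = bsplinePiece t j e i x) :
    HasDerivWithinAt (spline b t k (e + 1) β) (spline b t k e (derivCoeff t e β) x) (Icc a b) x := by
  have hpiece : ∀ j, d ≤ j → j < k → HasDerivWithinAt (spline b t k (e + 1) β)
      (spline b t k e (derivCoeff t e β) x) (Icc (t j) (t (j + 1))) x := by
    intro j hd hk
    by_cases hj : x ∈ Icc (t j) (t (j + 1))
    · have hder := HasDerivAt.fun_sum (u := Finset.range k) fun i _ =>
        (hasDerivAt_bsplinePiece (j := j) H.monotone e i x).const_mul (β i)
      refine (hder.hasDerivWithinAt.congr (fun y hy => ?_) ?_).congr_deriv ?_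
      · exact Finset.sum_congr rfl fun i _ => by rw [H.bspline_succ_eq_piece hd hk hy]
      · exact Finset.sum_congr rfl fun i _ => by rw [H.bspline_succ_eq_piece hd hk hj]
      · rw [spline]
        simp_rw [hx j hd hk hj]
        obtain ⟨n, rfl⟩ : ∃ n, k = n + 1 := ⟨k - 1, by omega⟩
        conv_rhs =>
          rw [Finset.sum_range_succ', show derivCoeff t e β 0 = 0 from rfl, zero_mul, add_zero]
        simp_rw [mul_sub]
        rw [Finset.sum_sub_distrib, Finset.sum_range_succ', Finset.sum_range_succ,
          bsplinePiece_eq_zero (i := 0) (by omega), bsplinePiece_eq_zero (i := n + 1) (by omega)]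
        simp only [zero_div, mul_zero, add_zero]
        rw [← Finset.sum_sub_distrib]
        exact Finset.sum_congr rfl fun i _ => by rw [derivCoeff]; ring
    -- Away from the closed interval, the derivative within it is a vacuous condition.
    · exact HasFDerivWithinAt.of_notMem_closure (by rwa [isClosed_Icc.closure_eq])
  have hunion : ∀ n, d + n + 1 ≤ k → HasDerivWithinAt (spline b t k (e + 1) β)
      (spline b t k e (derivCoeff t e β) x) (Icc (t d) (t (d + n + 1))) x := by
    intro n
    induction n with
    | zero => exact fun h => hpiece d le_rfl h
    | succ n ih =>
      intro h
      have := (ih (by omega)).union (hpiece (d + n + 1) (by omega) (by omega))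
      rwa [Icc_union_Icc_eq_Icc (H.monotone (by omega)) (H.monotone (by omega))] at this
  have hlt := H.lt
  have := hunion (k - d - 1) (by omega)
  rwa [show d + (k - d - 1) + 1 = k by omega, H.left, H.right] at this

theorem hasDerivWithinAt_spline {e : ℕ} (he : e + 2 ≤ d) (β : ℕ → ℝ) (x : ℝ) :
    HasDerivWithinAt (spline b t k (e + 2) β) (spline b t k (e + 1) (derivCoeff t (e + 1) β) x)
      (Icc a b) x :=
  H.hasDerivWithinAt_spline_of_eq_piece he β fun _ hd hk hj i =>
    H.bspline_succ_eq_piece hd hk hj e i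

theorem tendsto_spline_nhdsGT (hd : d ≤ j) (hk : j < k) (e : ℕ) (β : ℕ → ℝ) :
    Tendsto (spline b t k e β) (𝓝[>] (t j)) (𝓝 (spline b t k e β (t j))) := by
  have hs := H.step j hd hk
  have heq : ∀ x ∈ Ico (t j) (t (j + 1)), spline b t k e β x =
      ∑ i ∈ Finset.range k, β i * bsplinePiece t j e i x := fun x hx =>
    Finset.sum_congr rfl fun i _ => by
      rw [H.bspline_eq_piece hd hk ⟨hx.1, hx.2.le⟩ (Or.inl hx.2)]
  have hc : Continuous fun x => ∑ i ∈ Finset.range k, β i * bsplinePiece t j e i x :=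
    continuous_finsetSum _ fun i _ => continuous_const.mul (continuous_bsplinePiece e i)
  rw [heq _ ⟨le_rfl, hs⟩]
  refine (hc.tendsto (t j) |>.mono_left nhdsWithin_le_nhds).congr' ?_
  filter_upwards [Ioo_mem_nhdsGT hs] with x hx
  exact (heq x ⟨hx.1.le, hx.2⟩).symm

theorem isSecondDeriv_spline {e : ℕ} (he : e + 2 ≤ d) (β : ℕ → ℝ) :
    IsSecondDeriv a b (spline b t k (e + 2) β)
      (spline b t k e (derivCoeff t e (derivCoeff t (e + 1) β))) := by
  have hd₁ := H.hasDerivWithinAt_spline he β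
  have hab : a < b := by
    have := H.step d le_rfl H.lt
    rw [← H.left, ← H.right]
    exact this.trans_le (H.monotone H.lt)
  have hderiv : ∀ x ∈ Icc a b, derivWithin (spline b t k (e + 2) β) (Icc a b) x =
      spline b t k (e + 1) (derivCoeff t (e + 1) β) x := fun x hx =>
    (hd₁ x).derivWithin (uniqueDiffOn_Icc hab x hx)
  -- The exceptional set omits `t k = b`, where B-splines are left-continuous by convention.
  refine ⟨fun x _ => (hd₁ x).differentiableWithinAt, (Finset.Ico d k).image t, ?_, ?_, ?_⟩
  · intro x hx
    simp only [Finset.coe_image, Finset.coe_Ico, mem_image, mem_Ico] at hx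
    obtain ⟨j, ⟨h1, h2⟩, rfl⟩ := hx
    have h3 := H.step j h1 h2
    exact ⟨H.left ▸ H.monotone h1, h3.trans_le (H.right ▸ H.monotone h2)⟩
  · intro x hx hxF
    refine (H.hasDerivWithinAt_spline_of_eq_piece (by omega) _ fun j hd hk hj i => ?_).congr
      hderiv (hderiv x hx)
    refine H.bspline_eq_piece hd hk hj ?_ _ i
    by_contra! h
    have hxj : t (j + 1) = x := le_antisymm h.1 hj.2
    exact hxF (Finset.mem_image.2 ⟨j + 1, Finset.mem_Ico.2 ⟨by omega, by omega⟩, hxj⟩)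
  · intro x hx
    obtain ⟨j, hj, rfl⟩ := Finset.mem_image.1 hx
    rw [Finset.mem_Ico] at hj
    exact H.tendsto_spline_nhdsGT hj.1 hj.2 _ _

/-- The value of a spline is a convex combination of the coefficients whose B-splines do not vanish
at `x`. -/
theorem abs_spline_sub_le {e : ℕ} (he : e ≤ d) (β : ℕ → ℝ) {x y M : ℝ} (hx : x ∈ Icc a b)
    (hβ : ∀ i < k, bspline b t e i x ≠ 0 → |β i - y| ≤ M) : |spline b t k e β x - y| ≤ M := by
  have hsum := H.sum_bspline hx he
  have h1 : spline b t k e β x - y =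
      ∑ i ∈ Finset.range k, (β i - y) * bspline b t e i x := by
    simp_rw [sub_mul, Finset.sum_sub_distrib, ← Finset.mul_sum, hsum, mul_one, spline]
  calc |spline b t k e β x - y|
      ≤ ∑ i ∈ Finset.range k, |(β i - y) * bspline b t e i x| := by
        rw [h1]; exact Finset.abs_sum_le_sum_abs _ _
    _ ≤ ∑ i ∈ Finset.range k, M * bspline b t e i x := by
        refine Finset.sum_le_sum fun i hi => ?_
        have hnn := H.bspline_nonneg hx e i
        rw [abs_mul, abs_of_nonneg hnn]
        by_cases h0 : bspline b t e i x = 0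
        · simp [h0]
        · exact mul_le_mul_of_nonneg_right (hβ i (Finset.mem_range.1 hi) h0) hnn
    _ = M := by rw [← Finset.mul_sum, hsum, mul_one]

theorem spline_affine {e : ℕ} (he : e ≤ d) (β : ℕ → ℝ) (p q : ℝ) {x : ℝ} (hx : x ∈ Icc a b) :
    spline b t k e (fun i => p * β i + q) x = p * spline b t k e β x + q := by
  simp_rw [spline, add_mul, Finset.sum_add_distrib, ← Finset.mul_sum, H.sum_bspline hx he,
    mul_assoc, ← Finset.mul_sum, mul_one]

/-- The support of a B-spline, in terms of knots. -/
theorem exists_piece_of_bspline_ne_zero {x : ℝ} (hx : x ∈ Icc a b) {e i : ℕ}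
    (h : bspline b t e i x ≠ 0) :
    ∃ j, d ≤ j ∧ j < k ∧ x ∈ Icc (t j) (t (j + 1)) ∧ i ≤ j ∧ j ≤ i + e := by
  obtain ⟨j, hd, hk, hj, hj'⟩ := H.exists_piece hx
  refine ⟨j, hd, hk, hj, ?_⟩
  rw [H.bspline_eq_piece hd hk hj hj'] at h
  by_contra hij
  exact h (bsplinePiece_eq_zero hij x)

end IsSimpleKnotSeq

/-! ### Knot averages and integration of splines -/

theorem knotAverage_succ_sub (t : ℕ → ℝ) (d i : ℕ) :
    knotAverage t d (i + 1) - knotAverage t d i = (t (i + 1 + d + 1) - t (i + 1)) / (d + 1) := by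
  rw [knotAverage, knotAverage, ← sub_div, ← Finset.sum_sub_distrib]
  have := Finset.sum_range_sub (fun l => t (i + 1 + l)) (d + 1)
  simp only [add_zero] at this
  rw [show i + 1 + d + 1 = i + 1 + (d + 1) by omega, ← this]
  congr 1
  exact Finset.sum_congr rfl fun l _ => by rw [show i + 1 + 1 + l = i + 1 + (l + 1) by omega]

theorem knotAverage_mem_Icc (ht : Monotone t) (d i : ℕ) :
    knotAverage t d i ∈ Icc (t i) (t (i + d + 2)) := by
  have hpos : (0 : ℝ) < d + 1 := by positivity
  constructor
  · rw [knotAverage, le_div_iff₀ hpos]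
    have := Finset.card_nsmul_le_sum (Finset.range (d + 1)) (fun l => t (i + 1 + l)) (t i)
      fun l _ => ht (by omega)
    simp only [Finset.card_range, nsmul_eq_mul] at this
    push_cast at this
    linarith
  · rw [knotAverage, div_le_iff₀ hpos]
    have := Finset.sum_le_card_nsmul (Finset.range (d + 1)) (fun l => t (i + 1 + l))
      (t (i + d + 2)) fun l hl => ht (by have := Finset.mem_range.1 hl; omega)
    simp only [Finset.card_range, nsmul_eq_mul] at this
    push_cast at this
    linarith

/-- Coefficients of a spline of degree `d + 1` whose derivative has the coefficients `γ`. -/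
def integralCoeff (t : ℕ → ℝ) (d : ℕ) (γ : ℕ → ℝ) (i : ℕ) : ℝ :=
  ∑ l ∈ Finset.range i, γ (l + 1) * (t (l + 1 + d + 1) - t (l + 1)) / (d + 1)

namespace IsSimpleKnotSeq

variable (H : IsSimpleKnotSeq a b d k t)
include H

theorem left_lt_right : a < b := by
  have := H.step d le_rfl H.lt
  rw [← H.left, ← H.right]
  exact this.trans_le (H.monotone H.lt)

/-- Boundary knots may coincide, but such a window of knots always contains an interval of the basic
partition. -/
theorem lt_add (hd : 1 ≤ d) {i : ℕ} (hi : 1 ≤ i) (hk : i < k) : t i < t (i + d) := by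
  have hlt := H.lt
  calc t i ≤ t (max i d) := H.monotone (le_max_left _ _)
    _ < t (max i d + 1) := H.step _ (le_max_right _ _) (by omega)
    _ ≤ t (i + d) := H.monotone (by omega)

theorem derivCoeff_integralCoeff {e : ℕ} (he : e + 1 = d) (γ : ℕ → ℝ) {i : ℕ} (hi : 1 ≤ i)
    (hk : i < k) : derivCoeff t e (integralCoeff t e γ) i = γ i := by
  obtain ⟨i, rfl⟩ : ∃ n, i = n + 1 := ⟨i - 1, by omega⟩
  have h := H.lt_add (by omega) hi hk
  rw [← he, ← add_assoc] at h
  have h' := (sub_pos.2 h).ne'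
  rw [derivCoeff, integralCoeff, integralCoeff, Finset.sum_range_succ, add_sub_cancel_left]
  have : (e : ℝ) + 1 ≠ 0 := by positivity
  field_simp

/-- The knots around a point of the support of a B-spline are close to that point, once projected
to the basic interval. -/
theorem abs_projIcc_sub_le {δ : ℝ} (hδ : 0 ≤ δ)
    (heven : ∀ i, d ≤ i → i ≤ k → t i = a + ((i : ℝ) - d) * δ) {i : ℕ} (hd : d ≤ j) (hk : j < k)
    (hij : i ≤ j) (hji : j + 1 ≤ i + d) {x y : ℝ} (hx : x ∈ Icc (t j) (t (j + 1)))
    (hy : y ∈ Icc (t i) (t (i + d))) :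
    |(projIcc a b H.left_lt_right.le y : ℝ) - x| ≤ d * δ := by
  have hab := H.left_lt_right
  have hj := heven j hd hk.le
  have hj1 := heven (j + 1) (by omega) hk
  have hb := heven k H.lt.le le_rfl
  rw [H.right] at hb
  push_cast at hj1
  have hji' : (j : ℝ) + 1 ≤ i + d := by exact_mod_cast hji
  have hij' : (i : ℝ) ≤ j := by exact_mod_cast hij
  have hd' : (d : ℝ) ≤ j := by exact_mod_cast hd
  -- A boundary knot may lie arbitrarily far outside `[a, b]`; it is then replaced by the end point,
  -- which is still at most `d` steps away.
  have hlow : t (j + 1) - d * δ ≤ max a (t i) := by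
    by_cases h : d ≤ i
    · refine le_max_of_le_right ?_
      rw [heven i h (by omega), hj1]
      nlinarith
    · refine le_max_of_le_left ?_
      have : (i : ℝ) ≤ d := by exact_mod_cast (by omega : i ≤ d)
      rw [hj1]
      nlinarith
  have hupp : min b (t (i + d)) ≤ t j + d * δ := by
    by_cases h : i + d ≤ k
    · refine min_le_of_right_le ?_
      rw [heven (i + d) (by omega) h, hj]
      push_cast
      nlinarith
    · refine min_le_of_left_le ?_
      have : (k : ℝ) ≤ i + d := by exact_mod_cast (by omega : k ≤ i + d)
      rw [hb, hj]
      nlinarith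
  have htja : a ≤ t j := H.left ▸ H.monotone hd
  have htjb : t (j + 1) ≤ b := H.right ▸ H.monotone hk
  rw [coe_projIcc, abs_le]
  constructor
  · have h1 : max a (t i) ≤ max a (min b y) := by
      refine max_le_max le_rfl (le_min ?_ hy.1)
      exact (H.monotone (by omega : i ≤ j + 1)).trans htjb
    linarith [hx.2]
  · have h2 : max a (min b y) ≤ t j + d * δ := by
      refine max_le (by nlinarith [(Nat.cast_nonneg d : (0 : ℝ) ≤ d)]) ?_
      exact (min_le_min le_rfl hy.2).trans hupp
    linarith [hx.1]

end IsSimpleKnotSeq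

/-! ### Approximation with a bounded second derivative -/

theorem abs_derivWithin_sub_le {h : ℝ → ℝ} (hh : h ∈ parameterSpace a b c)
    {x y : ℝ} (hx : x ∈ Icc a b) (hy : y ∈ Icc a b) :
    |derivWithin h (Icc a b) x - derivWithin h (Icc a b) y| ≤ c * |x - y| :=
  (convex_Icc a b).norm_image_sub_le_of_norm_derivWithin_le hh.2.2.1 hh.2.2.2 hy hx

theorem parameterSpace_bound_nonneg (hab : a < b) {h : ℝ → ℝ} (hh : h ∈ parameterSpace a b c) :
    0 ≤ c :=
  (abs_nonneg _).trans (hh.2.2.2 a (left_mem_Icc.2 hab.le))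

/-- The spline whose derivative interpolates `h'` at the projected knot averages in its
coefficients approximates `h`, and its second derivative obeys the same bound. -/
theorem exists_spline_approx {m : ℕ} (H : IsSimpleKnotSeq a b (m + 2) k t) {δ : ℝ} (hδ : 0 ≤ δ)
    (heven : ∀ i, m + 2 ≤ i → i ≤ k → t i = a + ((i : ℝ) - (m + 2 : ℕ)) * δ) {h : ℝ → ℝ}
    (hh : h ∈ parameterSpace a b c) :
    ∃ β : ℕ → ℝ, ∃ f₂ : ℝ → ℝ, IsSecondDeriv a b (spline b t k (m + 2) β) f₂ ∧
      (∀ x ∈ Icc a b, |f₂ x| ≤ c) ∧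
      ∃ q : ℝ, ∀ x ∈ Icc a b,
        |spline b t k (m + 2) β x + q - h x| ≤ c * ((m + 2 : ℕ) * δ) * (b - a) := by
  have hab := H.left_lt_right
  have hc := parameterSpace_bound_nonneg hab hh
  set h' := derivWithin h (Icc a b) with hh'
  set γ : ℕ → ℝ := fun i => h' (projIcc a b hab.le (knotAverage t m i)) with hγ
  set β := integralCoeff t (m + 1) γ with hβ
  have hβγ : ∀ i, 1 ≤ i → i < k → derivCoeff t (m + 1) β i = γ i := fun i hi hk =>
    H.derivCoeff_integralCoeff rfl γ hi hk
  -- The constant of integration is chosen so that the error vanishes at `a`.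
  refine ⟨β, _, H.isSecondDeriv_spline le_rfl β, fun x hx => ?_,
    h a - spline b t k (m + 2) β a, fun x hx => ?_⟩
  · have key := H.abs_spline_sub_le (e := m) (by omega)
      (derivCoeff t m (derivCoeff t (m + 1) β)) (y := 0) (M := c) hx ?_
    · simpa using key
    intro i hi hne
    obtain ⟨j, hd, hk, -, hij, hji⟩ := H.exists_piece_of_bspline_ne_zero hx hne
    -- The support forces `i ≥ 2`, so both coefficients of the first derivative that enter here have
    -- index at least `1`, where they equal `γ`.
    obtain ⟨n, rfl⟩ : ∃ n, i = n + 1 := ⟨i - 1, by omega⟩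
    rw [derivCoeff, hβγ _ (by omega) hi, hβγ _ (by omega) (by omega), sub_zero, abs_div, abs_mul,
      abs_of_nonneg (by positivity : (0 : ℝ) ≤ m + 1)]
    have hD : 0 ≤ t (n + 1 + m + 1) - t (n + 1) := sub_nonneg.2 (H.monotone (by omega))
    rw [abs_of_nonneg hD]
    refine div_le_of_le_mul₀ hD hc ?_
    have h1 : |γ (n + 1) - γ n| ≤ c * ((t (n + 1 + m + 1) - t (n + 1)) / (m + 1)) := by
      refine (abs_derivWithin_sub_le hh (Subtype.coe_prop _) (Subtype.coe_prop _)).trans ?_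
      refine mul_le_mul_of_nonneg_left ?_ hc
      -- Projection is 1-Lipschitz, so it does not increase the spacing of the knot averages.
      refine (abs_projIcc_sub_projIcc hab.le).trans ?_
      rw [knotAverage_succ_sub, abs_of_nonneg (by positivity)]
    calc ((m : ℝ) + 1) * |γ (n + 1) - γ n|
        ≤ (m + 1) * (c * ((t (n + 1 + m + 1) - t (n + 1)) / (m + 1))) :=
          mul_le_mul_of_nonneg_left h1 (by positivity)
      _ = c * (t (n + 1 + m + 1) - t (n + 1)) := by field_simp
  · have hder : ∀ y ∈ Icc a b, HasDerivWithinAt (fun y => spline b t k (m + 2) β y - h y)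
        (spline b t k (m + 1) (derivCoeff t (m + 1) β) y - h' y) (Icc a b) y := fun y hy =>
      (H.hasDerivWithinAt_spline le_rfl β y).sub (hh.2.1 y hy).hasDerivWithinAt
    have hbound : ∀ y ∈ Icc a b,
        ‖spline b t k (m + 1) (derivCoeff t (m + 1) β) y - h' y‖ ≤ c * ((m + 2 : ℕ) * δ) := by
      intro y hy
      refine H.abs_spline_sub_le (by omega) _ hy fun i hi hne => ?_
      obtain ⟨j, hd, hk, hj, hij, hji⟩ := H.exists_piece_of_bspline_ne_zero hy hne
      rw [hβγ i (by omega) hi]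
      refine (abs_derivWithin_sub_le hh (Subtype.coe_prop _) hy).trans ?_
      refine mul_le_mul_of_nonneg_left ?_ hc
      exact H.abs_projIcc_sub_le hδ heven hd hk hij (by omega) hj
        (knotAverage_mem_Icc H.monotone m i)
    have hmv := (convex_Icc a b).norm_image_sub_le_of_norm_hasDerivWithin_le hder hbound
      (left_mem_Icc.2 hab.le) hx
    rw [Real.norm_eq_abs, Real.norm_eq_abs, abs_of_nonneg (sub_nonneg.2 hx.1)] at hmv
    rw [show spline b t k (m + 2) β x + (h a - spline b t k (m + 2) β a) - h x =
      spline b t k (m + 2) β x - h x - (spline b t k (m + 2) β a - h a) by ring]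
    refine hmv.trans (mul_le_mul_of_nonneg_left (by linarith [hx.2]) (by positivity))

/-! ### Contraction into the unit interval -/

theorem IsSecondDeriv.affine (hab : a < b) {f f₂ g : ℝ → ℝ} (hf : IsSecondDeriv a b f f₂) (p q : ℝ)
    (hg : ∀ x ∈ Icc a b, g x = p * f x + q) : IsSecondDeriv a b g fun x => p * f₂ x := by
  obtain ⟨hd, F, hF, h₁, h₂⟩ := hf
  have hg' : ∀ x ∈ Icc a b, HasDerivWithinAt g (p * derivWithin f (Icc a b) x) (Icc a b) x :=
    fun x hx => (((hd x hx).hasDerivWithinAt.const_mul p).add_const q).congr hg (hg x hx)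
  have hder : ∀ x ∈ Icc a b, derivWithin g (Icc a b) x = p * derivWithin f (Icc a b) x :=
    fun x hx => (hg' x hx).derivWithin (uniqueDiffOn_Icc hab x hx)
  exact ⟨fun x hx => (hg' x hx).differentiableWithinAt, F, hF,
    fun x hx hxF => ((h₁ x hx hxF).const_mul p).congr hder (hder x hx),
    fun x hx => (h₂ x hx).const_mul p⟩

theorem linComb_bsplineVec (b : ℝ) (t : ℕ → ℝ) (s k : ℕ) (β : ℕ → ℝ) :
    linComb (bsplineVec b s k t) (fun i => β i) = spline b t k (s - 1) β :=
  funext fun x => Fin.sum_univ_eq_sum_range (fun i => β i * bspline b t (s - 1) i x) k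

theorem exists_constrained_approx {m : ℕ} (H : IsSimpleKnotSeq a b (m + 2) k t) {δ : ℝ}
    (hδ : 0 ≤ δ)
    (heven : ∀ i, m + 2 ≤ i → i ≤ k → t i = a + ((i : ℝ) - (m + 2 : ℕ)) * δ) {h : ℝ → ℝ}
    (hh : h ∈ parameterSpace a b c) {ε : ℝ} (hε : c * ((m + 2 : ℕ) * δ) * (b - a) ≤ ε) :
    ∃ β : Fin k → ℝ,
      (∀ x ∈ Icc a b, |linComb (bsplineVec b (m + 3) k t) β x - h x| ≤ 2 * ε) ∧
      MeetsConstraints a b c (linComb (bsplineVec b (m + 3) k t) β) := by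
  have hab := H.left_lt_right
  have hc := parameterSpace_bound_nonneg hab hh
  obtain ⟨β, f₂, hf₂, hbd, q, hq⟩ := exists_spline_approx H hδ heven hh
  have hε0 : 0 ≤ ε := le_trans (mul_nonneg (by positivity) (by linarith)) hε
  have hpos : 0 < 1 + 2 * ε := by linarith
  -- The shifted spline takes values in `[-ε, 1 + ε]`; adding `ε` and multiplying by `p` maps this
  -- interval onto `[0, 1]`.
  set p := (1 + 2 * ε)⁻¹ with hp
  have hp0 : 0 < p := inv_pos.2 hpos
  have hp1 : p ≤ 1 := inv_le_one_of_one_le₀ (by linarith)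
  have hpm : p * (1 + 2 * ε) = 1 := inv_mul_cancel₀ hpos.ne'
  have hval : ∀ x ∈ Icc a b,
      linComb (bsplineVec b (m + 3) k t) (fun i => p * β i + p * (q + ε)) x =
        p * spline b t k (m + 2) β x + p * (q + ε) := fun x hx => by
    rw [linComb_bsplineVec b t (m + 3) k fun i => p * β i + p * (q + ε)]
    exact H.spline_affine le_rfl β p _ hx
  refine ⟨fun i => p * β i + p * (q + ε), fun x hx => ?_,
    fun x => p * f₂ x, hf₂.affine hab p _ hval, fun x hx => ?_⟩
  · have h1 := abs_le.1 ((hq x hx).trans hε)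
    have h2 := hh.1 hx
    rw [hval x hx, abs_le]
    have key : p * spline b t k (m + 2) β x + p * (q + ε) - h x =
        p * ((spline b t k (m + 2) β x + q - h x) + ε * (1 - 2 * h x)) := by
      linear_combination h x * hpm
    have h3 : |(spline b t k (m + 2) β x + q - h x) + ε * (1 - 2 * h x)| ≤ 2 * ε := by
      rw [abs_le]
      constructor <;> nlinarith [h1.1, h1.2, h2.1, h2.2]
    rw [← abs_le, key, abs_mul, abs_of_pos hp0]
    exact (mul_le_of_le_one_left (abs_nonneg _) hp1).trans h3
  · have h1 := abs_le.1 ((hq x hx).trans hε)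
    have h2 := hh.1 hx
    have h3 : |p * f₂ x| ≤ c := by
      rw [abs_mul, abs_of_pos hp0]
      exact (mul_le_of_le_one_left (abs_nonneg _) hp1).trans (hbd x hx)
    have h4 := abs_le.1 h3
    have h5 : p * spline b t k (m + 2) β x + p * (q + ε) =
        p * (spline b t k (m + 2) β x + q + ε) := by ring
    have h6 : 0 ≤ p * (spline b t k (m + 2) β x + q + ε) :=
      mul_nonneg hp0.le (by linarith [h2.1])
    have h7 : p * (spline b t k (m + 2) β x + q + ε) ≤ 1 := by
      rw [← hpm]
      exact mul_le_mul_of_nonneg_left (by linarith [h2.2]) hp0.le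
    intro i
    rw [constraintVec, hval x hx, h5]
    fin_cases i
    · simpa using h7
    · simpa using h6
    · simpa using h4.2
    · simp; linarith [h4.1]

/-! ### Evenly spaced knots and the rate -/

theorem IsEvenKnotSeq.eq_add_mul {m : ℕ} (ht : IsEvenKnotSeq a b (m + 3) k t) {i : ℕ}
    (hi : m + 2 ≤ i) (hk : i ≤ k) :
    t i = a + ((i : ℝ) - (m + 2 : ℕ)) * ((b - a) / ((k : ℝ) - (m + 3 : ℕ) + 1)) := by
  have h := ht.2 (i - (m + 2)) (by omega)
  rwa [show m + 3 - 1 + (i - (m + 2)) = i by omega, Nat.cast_sub hi] at h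

theorem IsEvenKnotSeq.isSimpleKnotSeq {m : ℕ} (hab : a < b) (hk : m + 3 ≤ k)
    (ht : IsEvenKnotSeq a b (m + 3) k t) : IsSimpleKnotSeq a b (m + 2) k t := by
  have hk' : ((m + 3 : ℕ) : ℝ) ≤ k := by exact_mod_cast hk
  have hpos : 0 < (k : ℝ) - (m + 3 : ℕ) + 1 := by linarith
  refine ⟨ht.1, by omega, ?_, ?_, fun j hj hjk => ?_⟩
  · simp [ht.eq_add_mul le_rfl (by omega : m + 2 ≤ k)]
  · rw [ht.eq_add_mul (by omega) le_rfl]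
    push_cast at hpos ⊢
    rw [show (k : ℝ) - (m + 2) = k - (m + 3) + 1 by ring, mul_div_cancel₀ _ hpos.ne']
    ring
  · rw [ht.eq_add_mul hj hjk.le, ht.eq_add_mul (by omega) hjk]
    have := div_pos (sub_pos.2 hab) hpos
    push_cast at this ⊢
    linarith

end SplineApprox

end

theorem theorem3p3 (a b c : ℝ) (hab : a < b) (s₀ : ℕ) (hs₀ : 3 ≤ s₀)
    (K : ℕ → ℕ) (hK : ∀ n, s₀ ≤ K n) (hK_tendsto : Filter.Tendsto K Filter.atTop Filter.atTop)
    (t : ℕ → ℕ → ℝ) (ht : ∀ n, SplineApprox.IsEvenKnotSeq a b s₀ (K n) (t n)) :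
    ∃ κ : ℕ → ℝ,
      SplineApprox.ApproximationAssumption a b c K
        (fun n => SplineApprox.bsplineVec b s₀ (K n) (t n)) κ ∧
      κ =O[Filter.atTop] (fun n => (K n : ℝ) ^ (-(1 / 2) : ℝ)) := by
  obtain ⟨m, rfl⟩ : ∃ m, s₀ = m + 3 := ⟨s₀ - 3, by omega⟩
  set N : ℕ → ℝ := fun n => (K n : ℝ) - (m + 3 : ℕ) + 1 with hN
  have hK' : ∀ n, ((m + 3 : ℕ) : ℝ) ≤ K n := fun n => by exact_mod_cast hK n
  have hN1 : ∀ n, 1 ≤ N n := fun n => by simp only [hN]; linarith [hK' n]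
  have hK1 : ∀ n, 1 ≤ (K n : ℝ) := fun n => by
    exact_mod_cast (by have := hK n; omega : 1 ≤ K n)
  -- The absolute value and the summand `1` keep the scalars positive even if `c ≤ 0`.
  set M : ℝ := |c| * (m + 2 : ℕ) * (b - a) * (b - a) + 1 with hM
  have hM0 : 0 < M := by
    have := sub_pos.2 hab
    positivity
  have hκ0 : ∀ n, 0 < 2 * (M / N n) := fun n => by
    have := hN1 n
    positivity
  have hO : (fun n => 2 * (M / N n)) =O[atTop] fun n => (K n : ℝ) ^ (-(1 / 2) : ℝ) := by
    refine Asymptotics.IsBigO.of_bound (2 * M * (m + 3 : ℕ)) (Eventually.of_forall fun n => ?_)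
    have hKpos : 0 < (K n : ℝ) := by linarith [hK1 n]
    rw [Real.norm_of_nonneg (hκ0 n).le, Real.norm_of_nonneg (Real.rpow_nonneg hKpos.le _)]
    -- Since `K n = N n + (m + 2)` and `N n ≥ 1`.
    have h1 : (K n : ℝ) ≤ (m + 3 : ℕ) * N n := by
      have h2 : (1 : ℝ) ≤ (m + 3 : ℕ) := by exact_mod_cast (by omega : 1 ≤ m + 3)
      simp only [hN]
      nlinarith [hK' n]
    calc 2 * (M / N n) ≤ 2 * M * (m + 3 : ℕ) * (K n : ℝ)⁻¹ := by
          have := hN1 n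
          rw [← div_eq_mul_inv, le_div_iff₀ hKpos, ← mul_div_assoc, div_mul_eq_mul_div,
            div_le_iff₀ (by linarith)]
          nlinarith
      -- The rate obtained is `1 / K n`, which is stronger than required because `K n ≥ 1`.
      _ ≤ 2 * M * (m + 3 : ℕ) * (K n : ℝ) ^ (-(1 / 2) : ℝ) := by
          refine mul_le_mul_of_nonneg_left ?_ (by positivity)
          rw [← Real.rpow_neg_one]
          exact Real.rpow_le_rpow_of_exponent_le (hK1 n) (by norm_num)
  refine ⟨fun n => 2 * (M / N n), ⟨hκ0, hO.trans_tendsto ?_, fun n h hh => ?_⟩, hO⟩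
  · exact (tendsto_rpow_neg_atTop (by norm_num : (0 : ℝ) < 1 / 2)).comp
      (tendsto_natCast_atTop_atTop.comp hK_tendsto)
  · have hN0 : 0 < N n := by linarith [hN1 n]
    refine SplineApprox.exists_constrained_approx ((ht n).isSimpleKnotSeq hab (hK n))
      (div_pos (sub_pos.2 hab) hN0).le (fun i h₁ h₂ => (ht n).eq_add_mul h₁ h₂) hh ?_
    rw [le_div_iff₀ hN0, hM, abs_of_nonneg (SplineApprox.parameterSpace_bound_nonneg hab hh)]
    have : c * ((m + 2 : ℕ) * ((b - a) / N n)) * (b - a) * N n =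
        c * (m + 2 : ℕ) * (b - a) * (b - a) := by field_simp
    linarith
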